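/- Let $X$ be a compact connected Riemann surface of genus $g\ge 2$, and let $\mathrm{Aut}(X)$ be its (finite) group of biholomorphic automorphisms. For a subgroup $H\le \mathrm{Aut}(X)$ and a point $p\in X$ let $D_{H,p}=\sum_{h\in H}h[p]$, the divisor in which each $h\in H$ contributes the point $h(p)$ with multiplicity one. Write $\sim$ for linear equivalence of divisors. Let $H,N,L\le \mathrm{Aut}(X)$ be subgroups with $L\subseteq N\cap H$ and $X/L\cong\mathbb P^1$ (as Riemann surfaces). Then: 1. if $|H|-|N|=|L|$, then $D_{H,p}-D_{N,q}\sim D_{L,r}$ for all $p,q,r\in X$; 2. if $|H|=|N|$, then $D_{H,p}\sim D_{N,q}$ for all $p,q\in X$. (So the classes of $D_H$, $D_N$, $D_L$ do not depend on the base points, and $D_H-D_N\sim D_L$, respectively $D_H\sim D_N$.) -/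

import Mathlib

open scoped Manifold ContDiff Topology

namespace RiemannSurface

/-! ### The projective line `ℙ¹` -/

/-- The complex projective line `ℙ¹ = ℂ ∪ {∞}`, as a topological space. -/
abbrev P1 : Type := OnePoint ℂ

/-- The map `z ↦ 1 / z` of `ℙ¹`, which exchanges `0` and `∞`. -/
noncomputable def P1.inv : P1 → P1
  | none => ((0 : ℂ) : P1)
  | some z => if z = 0 then OnePoint.infty else ((z⁻¹ : ℂ) : P1)

theorem P1.inv_infty : P1.inv OnePoint.infty = ((0 : ℂ) : P1) := rfl

theorem P1.inv_zero : P1.inv ((0 : ℂ) : P1) = OnePoint.infty :=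
  if_pos rfl

theorem P1.inv_coe {z : ℂ} (hz : z ≠ 0) : P1.inv (z : P1) = ((z⁻¹ : ℂ) : P1) :=
  if_neg hz

theorem P1.inv_inv (x : P1) : P1.inv (P1.inv x) = x := by
  induction x using OnePoint.rec with
  | infty => rw [P1.inv_infty, P1.inv_zero]
  | coe z =>
    by_cases hz : z = 0
    · rw [hz, P1.inv_zero, P1.inv_infty]
    · rw [P1.inv_coe hz, P1.inv_coe (inv_ne_zero hz), _root_.inv_inv]

theorem P1.continuous_inv : Continuous P1.inv := by
  have key : Filter.Tendsto ((↑) : ℂ → P1) (Bornology.cobounded ℂ) (𝓝 OnePoint.infty) := by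
    rw [Metric.cobounded_eq_cocompact, ← Filter.coclosedCompact_eq_cocompact]
    exact OnePoint.tendsto_coe_infty
  rw [continuous_iff_continuousAt]
  intro x
  induction x using OnePoint.rec with
  | infty =>
    rw [OnePoint.continuousAt_infty', P1.inv_infty, Filter.coclosedCompact_eq_cocompact,
      ← Metric.cobounded_eq_cocompact]
    have h1 : Filter.Tendsto (fun z : ℂ => ((z⁻¹ : ℂ) : P1)) (Bornology.cobounded ℂ)
        (𝓝 ((0 : ℂ) : P1)) :=
      (OnePoint.continuous_coe.tendsto (0 : ℂ)).comp Filter.tendsto_inv₀_cobounded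
    refine h1.congr' ?_
    filter_upwards [Bornology.eventually_ne_cobounded (0 : ℂ)] with z hz
    exact (P1.inv_coe hz).symm
  | coe z =>
    rw [OnePoint.continuousAt_coe]
    by_cases hz : z = 0
    · subst hz
      rw [continuousAt_iff_punctured_nhds]
      show Filter.Tendsto _ _ (𝓝 (P1.inv ((0 : ℂ) : P1)))
      rw [P1.inv_zero]
      refine (key.comp Filter.tendsto_inv₀_nhdsNE_zero).congr' ?_
      filter_upwards [self_mem_nhdsWithin] with w hw
      exact (P1.inv_coe hw).symm
    · have h1 : ContinuousAt (fun w : ℂ => ((w⁻¹ : ℂ) : P1)) z :=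
        OnePoint.continuous_coe.continuousAt.comp (continuousAt_inv₀ hz)
      refine h1.congr ?_
      filter_upwards [isOpen_ne.mem_nhds hz] with w hw
      exact (P1.inv_coe hw).symm

/-- The map `z ↦ 1 / z` as a homeomorphism of `ℙ¹`. -/
noncomputable def P1.invHomeomorph : P1 ≃ₜ P1 where
  toFun := P1.inv
  invFun := P1.inv
  left_inv := P1.inv_inv
  right_inv := P1.inv_inv
  continuous_toFun := P1.continuous_inv
  continuous_invFun := P1.continuous_inv

/-- The affine chart `z` of `ℙ¹`, with domain `ℂ`. -/
noncomputable def P1.chartZero : OpenPartialHomeomorph P1 ℂ :=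
  (OnePoint.isOpenEmbedding_coe.toOpenPartialHomeomorph ((↑) : ℂ → P1)).symm

/-- The affine chart `1 / z` of `ℙ¹`, with domain `ℙ¹ ∖ {0}`. -/
noncomputable def P1.chartInfty : OpenPartialHomeomorph P1 ℂ :=
  P1.invHomeomorph.toOpenPartialHomeomorph.trans P1.chartZero

theorem P1.chartZero_source : P1.chartZero.source = Set.range ((↑) : ℂ → P1) := by
  simp [P1.chartZero]

theorem P1.chartZero_coe (z : ℂ) : P1.chartZero (z : P1) = z :=
  (OnePoint.isOpenEmbedding_coe.toOpenPartialHomeomorph ((↑) : ℂ → P1)).left_inv (by simp)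

theorem P1.chartInfty_source :
    P1.chartInfty.source = P1.inv ⁻¹' Set.range ((↑) : ℂ → P1) := by
  rw [P1.chartInfty, OpenPartialHomeomorph.trans_source, P1.chartZero_source]
  exact Set.univ_inter _

open Classical in
noncomputable instance : ChartedSpace ℂ P1 where
  atlas := {P1.chartZero, P1.chartInfty}
  chartAt x := if x = OnePoint.infty then P1.chartInfty else P1.chartZero
  mem_chart_source x := by
    split_ifs with h
    · rw [h, P1.chartInfty_source]
      exact ⟨0, P1.inv_infty.symm⟩
    · rw [P1.chartZero_source]
      obtain ⟨z, hz⟩ := OnePoint.ne_infty_iff_exists.1 h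
      exact ⟨z, hz⟩
  chart_mem_atlas x := by
    split_ifs
    · exact Or.inr rfl
    · exact Or.inl rfl

/-- The transition map between the two affine charts is `z ↦ z⁻¹` on `ℂ ∖ {0}`. -/
theorem P1.contDiffOn_transition {f : ℂ → ℂ} {s : Set ℂ}
    (hs : ∀ z ∈ s, z ≠ 0) (hf : ∀ z ∈ s, f z = z⁻¹) : ContDiffOn ℂ ω f s :=
  ContDiffOn.congr (fun z hz => (contDiffAt_inv ℂ (hs z hz)).contDiffWithinAt) hf

theorem P1.chartZero_symm (z : ℂ) : P1.chartZero.symm z = (z : P1) := rfl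

theorem P1.chartInfty_symm (z : ℂ) : P1.chartInfty.symm z = P1.inv (z : P1) := rfl

theorem P1.chartInfty_apply (x : P1) : P1.chartInfty x = P1.chartZero (P1.inv x) := rfl

instance : IsManifold 𝓘(ℂ) ω P1 := by
  apply isManifold_of_contDiffOn
  have mem (z : ℂ) (h : P1.inv (z : P1) ∈ Set.range ((↑) : ℂ → P1)) : z ≠ 0 := by
    rintro rfl
    rw [P1.inv_zero] at h
    exact OnePoint.infty_notMem_range_coe h
  rintro e e' (rfl | rfl) (rfl | rfl)
  · refine contDiffOn_id.congr ?_
    intro z _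
    exact P1.chartZero_coe z
  · have h0 : ∀ z ∈ (𝓘(ℂ).symm ⁻¹' (P1.chartZero.symm.trans P1.chartInfty).source ∩
        Set.range 𝓘(ℂ)), z ≠ 0 := by
      rintro z ⟨hz, -⟩
      have h2 : (z : P1) ∈ P1.chartInfty.source := hz.2
      rw [P1.chartInfty_source] at h2
      exact mem z h2
    refine P1.contDiffOn_transition h0 fun z hz => ?_
    show P1.chartZero (P1.inv (z : P1)) = z⁻¹
    rw [P1.inv_coe (h0 z hz), P1.chartZero_coe]
  · have h0 : ∀ z ∈ (𝓘(ℂ).symm ⁻¹' (P1.chartInfty.symm.trans P1.chartZero).source ∩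
        Set.range 𝓘(ℂ)), z ≠ 0 := by
      rintro z ⟨hz, -⟩
      have h2 : P1.inv (z : P1) ∈ P1.chartZero.source := hz.2
      rw [P1.chartZero_source] at h2
      exact mem z h2
    refine P1.contDiffOn_transition h0 fun z hz => ?_
    show P1.chartZero (P1.inv (z : P1)) = z⁻¹
    rw [P1.inv_coe (h0 z hz), P1.chartZero_coe]
  · refine contDiffOn_id.congr ?_
    intro z _
    show P1.chartZero (P1.inv (P1.inv (z : P1))) = z
    rw [P1.inv_inv, P1.chartZero_coe]

/-! ### Automorphisms, quotients, divisors

In this part `X` is a one-dimensional complex manifold. -/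

section

variable (X : Type*) [TopologicalSpace X] [ChartedSpace ℂ X]

/-- The group `Aut(X)` of biholomorphic maps `X → X`. -/
def Aut : Subgroup (Equiv.Perm X) where
  carrier := {e | ContMDiff 𝓘(ℂ) 𝓘(ℂ) ω e ∧ ContMDiff 𝓘(ℂ) 𝓘(ℂ) ω e.symm}
  mul_mem' := fun ha hb => ⟨ha.1.comp hb.1, hb.2.comp ha.2⟩
  one_mem' := ⟨contMDiff_id, contMDiff_id⟩
  inv_mem' := fun ha => ⟨ha.2, ha.1⟩

variable {X}

/-- `X / L ≅ ℙ¹`: the orbit space `X / L` (with the quotient topology), made into a Riemann surface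
by the complex structure for which the projection `X → X / L` is holomorphic (for a finite group
`L` there is exactly one), is biholomorphic to `ℙ¹`. -/
def QuotientIsoP1 (L : Subgroup (Aut X)) : Prop :=
  ∃ (_ : ChartedSpace ℂ (MulAction.orbitRel.Quotient L X))
    (_ : IsManifold 𝓘(ℂ) ω (MulAction.orbitRel.Quotient L X)),
    ContMDiff 𝓘(ℂ) 𝓘(ℂ) ω
      (fun x : X => (Quotient.mk (MulAction.orbitRel L X) x : MulAction.orbitRel.Quotient L X)) ∧
    Nonempty (Diffeomorph 𝓘(ℂ) 𝓘(ℂ) (MulAction.orbitRel.Quotient L X) P1 ω)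

/-- `f` is meromorphic at `p`, in the local coordinate given by the chart of `X` at `p`. The value
of `f` at a pole is irrelevant. -/
def MeromorphicAtPoint (f : X → ℂ) (p : X) : Prop :=
  MeromorphicAt (f ∘ (chartAt ℂ p).symm) (chartAt ℂ p p)

/-- The order of vanishing `ord_p f` of a meromorphic function (negative at a pole, and `⊤` if `f`
vanishes identically around `p`). -/
noncomputable def orderAtPoint (f : X → ℂ) (p : X) : WithTop ℤ :=
  meromorphicOrderAt (f ∘ (chartAt ℂ p).symm) (chartAt ℂ p p)

variable (X) in
/-- Divisors on a compact Riemann surface: finite formal `ℤ`-linear combinations of points. -/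
abbrev Divisor : Type _ := X →₀ ℤ

/-- `D = div f` for some meromorphic function `f` that is not identically zero: the order of `f` at
each point is finite and equals the coefficient of `D`. -/
def Divisor.IsPrincipal (D : Divisor X) : Prop :=
  ∃ f : X → ℂ, (∀ p, MeromorphicAtPoint f p) ∧ ∀ p, orderAtPoint f p = ((D p : ℤ) : WithTop ℤ)

/-- Linear equivalence `D ∼ E` of divisors. -/
def Divisor.LinEquiv (D E : Divisor X) : Prop :=
  Divisor.IsPrincipal (D - E)

/-- The divisor `D_{H,p} = ∑_{h ∈ H} h[p]` induced by a finite group `H` of automorphisms. -/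
noncomputable def inducedDivisor (H : Subgroup (Aut X)) (p : X) : Divisor X :=
  ∑ᶠ h : H, Finsupp.single (h • p) (1 : ℤ)

end

end RiemannSurface

/-! The group `L` carries everything. The projection `φ : X → X/L ≅ ℙ¹` has the `L`-orbits as
fibres, and its multiplicity at `x` is the order of the stabilizer `L_x`. Hence `D_{L,p}` is the
fibre of `φ` through `p`, counted with multiplicity. Any two points of `ℙ¹` are linearly equivalent,
so the class of `D_{L,p}` is independent of `p` (`QuotientIsoP1.linEquiv_inducedDivisor`).

Splitting `H` into right cosets of `L` writes `D_{H,p}` as a sum of `[H : L]` divisors of the form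
`D_{L,p'}`, so `D_H ∼ [H : L] D_L`, and likewise for `N` (`exists_linEquiv_nsmul_inducedDivisor`).
The two cardinality hypotheses become `[H : L] = [N : L] + 1` and `[H : L] = [N : L]`.

The analytic core is the multiplicity (`meromorphicOrderAt_sub_eq_card_stabilizer`). In a suitable
coordinate `u` the map is `u ^ e` up to a constant, and the `e` points of a nearby fibre correspond
to the elements of `L_x`, because nontrivial automorphisms have isolated fixed points. -/

namespace RiemannSurface

/-! ### Linear equivalence of divisors -/

section LinearEquivalence

variable {X : Type*} [TopologicalSpace X] [ChartedSpace ℂ X]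

theorem Divisor.isPrincipal_zero : (0 : Divisor X).IsPrincipal := by
  classical
  refine ⟨fun _ => 1, fun p => MeromorphicAt.const _ _, fun p => ?_⟩
  exact (meromorphicOrderAt_const (chartAt ℂ p p) (1 : ℂ)).trans (by simp)

theorem Divisor.IsPrincipal.add {D E : Divisor X} (hD : D.IsPrincipal) (hE : E.IsPrincipal) :
    (D + E).IsPrincipal := by
  obtain ⟨f, hf, hfD⟩ := hD
  obtain ⟨g, hg, hgE⟩ := hE
  refine ⟨f * g, fun p => (hf p).mul (hg p), fun p => ?_⟩
  refine (meromorphicOrderAt_mul (hf p) (hg p)).trans ?_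
  have h1 := hfD p
  have h2 := hgE p
  unfold orderAtPoint at h1 h2
  rw [h1, h2, Finsupp.add_apply]
  norm_cast

theorem Divisor.IsPrincipal.neg {D : Divisor X} (hD : D.IsPrincipal) : (-D).IsPrincipal := by
  obtain ⟨f, hf, hfD⟩ := hD
  refine ⟨f⁻¹, fun p => (hf p).inv, fun p => ?_⟩
  refine (meromorphicOrderAt_inv (f := f ∘ (chartAt ℂ p).symm)).trans ?_
  have h1 := hfD p
  unfold orderAtPoint at h1
  rw [h1, Finsupp.neg_apply]
  rfl

theorem Divisor.LinEquiv.refl (D : Divisor X) : D.LinEquiv D := by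
  unfold Divisor.LinEquiv
  rw [sub_self]
  exact isPrincipal_zero

theorem Divisor.LinEquiv.symm {D E : Divisor X} (h : D.LinEquiv E) : E.LinEquiv D := by
  unfold Divisor.LinEquiv
  rw [← neg_sub]
  exact h.neg

theorem Divisor.LinEquiv.trans {D E F : Divisor X} (h : D.LinEquiv E) (h' : E.LinEquiv F) :
    D.LinEquiv F := by
  unfold Divisor.LinEquiv
  rw [← sub_add_sub_cancel]
  exact h.add h'

theorem Divisor.LinEquiv.add {D E D' E' : Divisor X} (h : D.LinEquiv E) (h' : D'.LinEquiv E') :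
    (D + D').LinEquiv (E + E') := by
  unfold Divisor.LinEquiv
  rw [add_sub_add_comm]
  exact Divisor.IsPrincipal.add h h'

theorem Divisor.LinEquiv.sub {D E D' E' : Divisor X} (h : D.LinEquiv E) (h' : D'.LinEquiv E') :
    (D - D').LinEquiv (E - E') := by
  unfold Divisor.LinEquiv
  rw [sub_sub_sub_comm, sub_eq_add_neg]
  exact Divisor.IsPrincipal.add h (Divisor.IsPrincipal.neg h')

theorem Divisor.LinEquiv.sum {ι : Type*} (s : Finset ι) {D E : ι → Divisor X}
    (h : ∀ i ∈ s, (D i).LinEquiv (E i)) : (∑ i ∈ s, D i).LinEquiv (∑ i ∈ s, E i) := by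
  classical
  induction s using Finset.induction_on with
  | empty => exact .refl _
  | insert a s ha ih =>
    rw [Finset.sum_insert ha, Finset.sum_insert ha]
    exact (h a (Finset.mem_insert_self a s)).add
      (ih fun i hi => h i (Finset.mem_insert_of_mem hi))

end LinearEquivalence

/-! ### Divisors induced by groups of automorphisms -/

section InducedDivisor

variable {X : Type*} [TopologicalSpace X] [ChartedSpace ℂ X]

theorem inducedDivisor_eq_sum (H : Subgroup (Aut X)) [Fintype H] (p : X) :
    inducedDivisor H p = ∑ h : H, Finsupp.single (h • p) (1 : ℤ) :=
  finsum_eq_sum_of_fintype _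

/-- No summand vanishes, so the support is infinite and the `finsum` takes its default value. -/
theorem inducedDivisor_of_infinite (H : Subgroup (Aut X)) [Infinite H] (p : X) :
    inducedDivisor H p = 0 := by
  refine finsum_of_infinite_support ?_
  have : (Function.support fun h : H => Finsupp.single (h • p) (1 : ℤ)) = Set.univ :=
    Set.eq_univ_of_forall fun h => by simp
  rw [this]
  exact Set.infinite_univ

theorem inducedDivisor_smul (H : Subgroup (Aut X)) [Finite H] (g : H) (p : X) :
    inducedDivisor H (g • p) = inducedDivisor H p := by
  have := Fintype.ofFinite H
  rw [inducedDivisor_eq_sum, inducedDivisor_eq_sum,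
    ← Equiv.sum_comp (Equiv.mulRight g) fun h : H => Finsupp.single (h • p) (1 : ℤ)]
  exact Finset.sum_congr rfl fun h _ => by rw [Equiv.coe_mulRight, mul_smul]

theorem inducedDivisor_apply_self (H : Subgroup (Aut X)) [Finite H] (p : X) :
    inducedDivisor H p p = Nat.card (MulAction.stabilizer H p) := by
  classical
  have := Fintype.ofFinite H
  rw [inducedDivisor_eq_sum, Finsupp.finsetSum_apply, Nat.card_eq_fintype_card,
    Fintype.card_subtype]
  simp [Finsupp.single_apply, MulAction.mem_stabilizer_iff]

/-- Moving the base point within its orbit reduces this to the case `p = x`. -/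
theorem inducedDivisor_apply_of_orbitRel (H : Subgroup (Aut X)) [Finite H] {p x : X}
    (h : MulAction.orbitRel H X x p) :
    inducedDivisor H p x = Nat.card (MulAction.stabilizer H x) := by
  obtain ⟨g, rfl⟩ := h
  show inducedDivisor H p (g • p) = Nat.card (MulAction.stabilizer H (g • p))
  rw [← inducedDivisor_apply_self, inducedDivisor_smul]

theorem inducedDivisor_apply_of_not_orbitRel (H : Subgroup (Aut X)) [Finite H] {p x : X}
    (h : ¬ MulAction.orbitRel H X x p) : inducedDivisor H p x = 0 := by
  have := Fintype.ofFinite H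
  rw [inducedDivisor_eq_sum, Finsupp.finsetSum_apply]
  refine Finset.sum_eq_zero fun g _ => Finsupp.single_eq_of_ne ?_
  rintro rfl
  exact h ⟨g, rfl⟩

/-- If the class of `D_{L,p}` does not depend on `p`, then `D_{H,p}` is linearly equivalent to
`[H : L]` times `D_{L,r}`. For infinite `H` the divisor is zero, and so is the factor. -/
theorem exists_linEquiv_nsmul_inducedDivisor {L H : Subgroup (Aut X)} [Finite L] (hLH : L ≤ H)
    (hL : ∀ p q : X, Divisor.LinEquiv (inducedDivisor L p) (inducedDivisor L q)) :
    ∃ k : ℕ, Nat.card H = k * Nat.card L ∧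
      ∀ p r : X, Divisor.LinEquiv (inducedDivisor H p) (k • inducedDivisor L r) := by
  classical
  cases finite_or_infinite H with
  | inr hH =>
    refine ⟨0, by simp, fun p r => ?_⟩
    rw [inducedDivisor_of_infinite, zero_smul]
    exact .refl _
  | inl hH =>
    have := Fintype.ofFinite H
    have := Fintype.ofFinite L
    have := Fintype.ofFinite (H ⧸ L.subgroupOf H)
    refine ⟨Nat.card (H ⧸ L.subgroupOf H), ?_, fun p r => ?_⟩
    · rw [Subgroup.card_eq_card_quotient_mul_card_subgroup (L.subgroupOf H),
        Nat.card_congr (Subgroup.subgroupOfEquivOfLe hLH).toEquiv]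
    · have hbij : Function.Bijective
          fun cs : (H ⧸ L.subgroupOf H) × L.subgroupOf H => (cs.1.out * (cs.2 : H))⁻¹ := by
        refine inv_injective.bijective_of_finite.comp ⟨fun ⟨c, s⟩ ⟨c', s'⟩ h => ?_, fun g => ?_⟩
        · have hc : c = c' := by
            have h1 := congrArg (QuotientGroup.mk : H → H ⧸ L.subgroupOf H) h
            rwa [QuotientGroup.mk_mul_of_mem _ s.2, QuotientGroup.mk_mul_of_mem _ s'.2,
              QuotientGroup.out_eq', QuotientGroup.out_eq'] at h1
          subst hc
          exact Prod.ext rfl (Subtype.ext (mul_left_cancel h))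
        · obtain ⟨s, hs⟩ := QuotientGroup.mk_out_eq_mul (L.subgroupOf H) g
          exact ⟨(QuotientGroup.mk g, s⁻¹), by simp [hs]⟩
      have key : inducedDivisor H p = ∑ c : H ⧸ L.subgroupOf H,
          inducedDivisor L ((c.out : H)⁻¹ • p) := by
        rw [inducedDivisor_eq_sum,
          ← hbij.sum_comp fun h : H => Finsupp.single (h • p) (1 : ℤ), Fintype.sum_prod_type]
        refine Finset.sum_congr rfl fun c _ => ?_
        rw [inducedDivisor_eq_sum,
          ← Equiv.sum_comp ((Subgroup.subgroupOfEquivOfLe hLH).toEquiv.trans (Equiv.inv L))]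
        refine Finset.sum_congr rfl fun s _ => ?_
        rw [mul_inv_rev, mul_smul]
        rfl
      rw [key, Nat.card_eq_fintype_card, ← Finset.card_univ, ← Finset.sum_const]
      exact .sum _ fun c _ => hL _ _

end InducedDivisor

end RiemannSurface

theorem OpenPartialHomeomorph.tendsto_nhdsNE {X Y : Type*} [TopologicalSpace X]
    [TopologicalSpace Y] (c : OpenPartialHomeomorph X Y) {x : X} (hx : x ∈ c.source) :
    Filter.Tendsto c (𝓝[≠] x) (𝓝[≠] (c x)) := by
  refine tendsto_nhdsWithin_iff.2
    ⟨(c.continuousAt hx).tendsto.mono_left nhdsWithin_le_nhds, ?_⟩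
  filter_upwards [self_mem_nhdsWithin,
    nhdsWithin_le_nhds (c.open_source.mem_nhds hx)] with y hy hys h
  exact hy (c.injOn hys hx h)

namespace RiemannSurface

/-! ### Local normal form of a holomorphic function -/

/-- A holomorphic function with a zero of order `n ≥ 1` is the `n`-th power of a local
coordinate. -/
theorem exists_openPartialHomeomorph_pow {f : ℂ → ℂ} {z₀ : ℂ} (hf : AnalyticAt ℂ f z₀) {n : ℕ}
    (hn : n ≠ 0) (h : analyticOrderAt f z₀ = n) :
    ∃ v : OpenPartialHomeomorph ℂ ℂ, z₀ ∈ v.source ∧ v z₀ = 0 ∧ ∀ᶠ z in 𝓝 z₀, f z = v z ^ n := by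
  obtain ⟨g, hg, hg0, hfg⟩ := hf.analyticOrderAt_eq_natCast.1 h
  obtain ⟨c, hc⟩ := IsAlgClosed.exists_pow_nat_eq (g z₀) (Nat.pos_of_ne_zero hn)
  have hc0 : c ≠ 0 := by
    rintro rfl
    exact hg0 (by rw [← hc, zero_pow hn])
  -- An `n`-th root of `g`. Dividing by `g z₀` puts the base of the power at `1`, inside the slit
  -- plane, where the principal branch is analytic; `c` restores the constant. The coordinate is `(z
  -- - z₀) * w z`, with derivative `c ≠ 0` at `z₀`.
  set w : ℂ → ℂ := fun z => c * (g z / g z₀) ^ ((n : ℂ)⁻¹) with hw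
  have hwa : AnalyticAt ℂ w z₀ := by
    refine analyticAt_const.mul ((hg.div_const).cpow analyticAt_const ?_)
    rw [div_self hg0]
    exact Complex.one_mem_slitPlane
  have hw0 : w z₀ = c := by simp [hw, div_self hg0]
  have hwn : ∀ z, w z ^ n = g z := fun z => by
    rw [hw, mul_pow, Complex.cpow_nat_inv_pow _ hn, hc, mul_div_cancel₀ _ hg0]
  have hva : AnalyticAt ℂ (fun z => (z - z₀) * w z) z₀ := by fun_prop
  have hd : HasStrictDerivAt (fun z => (z - z₀) * w z) c z₀ := by
    have h1 : HasStrictDerivAt (fun z : ℂ => z - z₀) 1 z₀ := (hasStrictDerivAt_id z₀).sub_const z₀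
    have h2 := h1.fun_mul hwa.hasStrictDerivAt
    simpa [hw0] using h2
  have hd' := hd.hasStrictFDerivAt_equiv hc0
  refine ⟨hd'.toOpenPartialHomeomorph _, hd'.mem_toOpenPartialHomeomorph_source, ?_, ?_⟩
  · rw [hd'.toOpenPartialHomeomorph_coe]
    simp
  · filter_upwards [hfg] with z hz
    rw [hd'.toOpenPartialHomeomorph_coe, hz, mul_pow, hwn, smul_eq_mul]

/-- If the fibres of `u ^ e` near `x` are the orbits of a finite group `L`, where `u` is a local
coordinate at `x`, and only the identity has fixed points in a punctured neighbourhood of `x`, then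
`e` is the order of the stabilizer of `x`. -/
theorem card_stabilizer_eq_of_pow {X : Type*} [TopologicalSpace X] [T2Space X] {L : Type*}
    [Group L] [Finite L] [MulAction L X] [ContinuousConstSMul L X] {x : X}
    (u : OpenPartialHomeomorph X ℂ) (hx : x ∈ u.source) (hu : u x = 0) {e : ℕ} (he : e ≠ 0)
    {W : Set X} (hW : W ∈ 𝓝 x)
    (hfib : ∀ y ∈ W, ∀ y' ∈ W, u y ^ e = u y' ^ e ↔ MulAction.orbitRel L X y y')
    (hfree : ∀ g : L, g ≠ 1 → ∀ᶠ y in 𝓝[≠] x, g • y ≠ y) :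
    e = Nat.card (MulAction.stabilizer L x) := by
  have : NeZero e := ⟨he⟩
  have hx0 : (0 : ℂ) ∈ u.target := hu ▸ u.map_source hx
  have hsymm0 : u.symm 0 = x := by rw [← hu, u.left_inv hx]
  have hcont : ContinuousAt u.symm 0 := u.continuousAt_symm hx0
  -- On `V`, two points related by an element of `L` are related only by elements of the stabilizer
  -- of `x`.
  obtain ⟨V, hV, hVsep⟩ : ∃ V ∈ 𝓝 x, ∀ g : L, g • x ≠ x → ∀ y ∈ V, ∀ y' ∈ V, g • y ≠ y' := by
    have h1 (g : L) : ∃ V ∈ 𝓝 x, g • x ≠ x → ∀ y ∈ V, ∀ y' ∈ V, g • y ≠ y' := by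
      by_cases hg : g • x = x
      · exact ⟨Set.univ, Filter.univ_mem, fun h => absurd hg h⟩
      · obtain ⟨A, B, hA, hB, hxA, hxB, hAB⟩ := t2_separation hg
        refine ⟨(g • ·) ⁻¹' A ∩ B, Filter.inter_mem
          ((continuous_const_smul g).continuousAt (hA.mem_nhds hxA)) (hB.mem_nhds hxB), ?_⟩
        intro _ y hy y' hy' hyy'
        have hyA : g • y ∈ A := hy.1
        rw [hyy'] at hyA
        exact Set.disjoint_left.1 hAB hyA hy'.2
    choose V hV hV' using h1
    exact ⟨⋂ g, V g, Filter.iInter_mem.2 hV, fun g hg y hy y' hy' =>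
      hV' g hg y (Set.mem_iInter.1 hy g) y' (Set.mem_iInter.1 hy' g)⟩
  have ev1 : ∀ᶠ t in 𝓝 (0 : ℂ), t ∈ u.target ∧ u.symm t ∈ V ∩ W :=
    Filter.Eventually.and (u.open_target.mem_nhds hx0)
      (hcont (by rw [hsymm0]; exact Filter.inter_mem hV hW))
  have ev2 : ∀ᶠ t in 𝓝 (0 : ℂ), ∀ ζ : rootsOfUnity e ℂ,
      ((ζ : ℂˣ) : ℂ) * t ∈ u.target ∧ u.symm (((ζ : ℂˣ) : ℂ) * t) ∈ V ∩ W := by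
    refine Filter.eventually_all.2 fun ζ => ?_
    have h2 : Filter.Tendsto (fun t : ℂ => ((ζ : ℂˣ) : ℂ) * t) (𝓝 0) (𝓝 0) := by
      have := (continuous_const_mul ((ζ : ℂˣ) : ℂ)).tendsto 0
      rwa [mul_zero] at this
    exact h2.eventually ev1
  have ev3 : ∀ᶠ t in 𝓝 (0 : ℂ), ∀ g : MulAction.stabilizer L x,
      g • u.symm t ∈ W ∩ u.source := by
    refine Filter.eventually_all.2 fun g => ?_
    have h3 : Filter.Tendsto (fun t => (g : L) • u.symm t) (𝓝 0) (𝓝 x) := by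
      have h4 : ContinuousAt (fun t => (g : L) • u.symm t) 0 :=
        (continuous_const_smul (g : L)).continuousAt.comp hcont
      have h5 : (g : L) • u.symm 0 = x := by rw [hsymm0]; exact g.2
      have h6 := h4.tendsto
      rwa [h5] at h6
    exact h3 (Filter.inter_mem hW (u.open_source.mem_nhds hx))
  have ev4 : ∀ᶠ t in 𝓝[≠] (0 : ℂ), ∀ g : L, g ≠ 1 → g • u.symm t ≠ u.symm t := by
    refine Filter.eventually_all.2 fun g => ?_
    by_cases hg : g = 1
    · exact Filter.Eventually.of_forall fun t h => absurd hg h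
    have h6 := u.symm.tendsto_nhdsNE hx0
    rw [hsymm0] at h6
    filter_upwards [h6.eventually (hfree g hg)] with t ht _ using ht
  obtain ⟨t, ⟨⟨⟨ht1, htVW⟩, ht2, ht3⟩, ht4⟩, ht0⟩ :=
    (((Filter.Eventually.filter_mono nhdsWithin_le_nhds (ev1.and (ev2.and ev3))).and ev4).and
      (self_mem_nhdsWithin : {(0 : ℂ)}ᶜ ∈ 𝓝[≠] (0 : ℂ))).exists
  replace ht0 : t ≠ 0 := ht0
  set y := u.symm t
  have huy : u y = t := u.right_inv ht1
  -- Two injections between the stabilizer and the `e`-th roots of unity: `ζ` gives some `g` with `u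
  -- (g • y) = ζ * t`, and `g` gives the root `u (g • y) / t`. The second is injective because `y`
  -- has trivial stabilizer in `L`.
  refine le_antisymm ?_ ?_
  · have h7 (ζ : rootsOfUnity e ℂ) :
        ∃ g : MulAction.stabilizer L x, g • y = u.symm (((ζ : ℂˣ) : ℂ) * t) := by
      have h8 : ((ζ : ℂˣ) : ℂ) ^ e = 1 := by
        have := (mem_rootsOfUnity e (ζ : ℂˣ)).1 ζ.2
        rw [← Units.val_pow_eq_pow_val, this, Units.val_one]
      obtain ⟨g, hg⟩ := (hfib _ (ht2 ζ).2.2 y htVW.2).1 (by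
        rw [u.right_inv (ht2 ζ).1, huy, mul_pow, h8, one_mul])
      refine ⟨⟨g, ?_⟩, hg⟩
      by_contra hgx
      exact hVsep g hgx y htVW.1 _ (ht2 ζ).2.1 hg
    choose g hg using h7
    rw [← Complex.card_rootsOfUnity e]
    refine Nat.card_le_card_of_injective g fun ζ ζ' h => ?_
    have h9 := (hg ζ).symm.trans ((congrArg (· • y) h).trans (hg ζ'))
    exact Subtype.ext (Units.ext (mul_right_cancel₀ ht0
      (u.symm.injOn (ht2 ζ).1 (ht2 ζ').1 h9)))
  · have h10 (g : MulAction.stabilizer L x) : (u (g • y) / t) ^ e = 1 := by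
      have := (hfib (g • y) (ht3 g).1 y htVW.2).2 ⟨(g : L), rfl⟩
      rw [div_pow, this, huy, div_self (pow_ne_zero e ht0)]
    rw [← Complex.card_rootsOfUnity e]
    refine Nat.card_le_card_of_injective
      (fun g => rootsOfUnity.mkOfPowEq (u (g • y) / t) (h10 g)) fun g g' h => ?_
    have h11 := congrArg (fun ζ : rootsOfUnity e ℂ => ((ζ : ℂˣ) : ℂ)) h
    simp only [rootsOfUnity.coe_mkOfPowEq] at h11
    have h12 : (g : L) • y = (g' : L) • y :=
      u.injOn (ht3 g).2 (ht3 g').2 ((div_left_inj' ht0).1 h11)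
    by_contra hne
    refine ht4 ((g' : L)⁻¹ * g) (fun h => hne (Subtype.ext (inv_mul_eq_one.1 h).symm)) ?_
    rw [mul_smul, h12, inv_smul_smul]

/-! ### Holomorphic maps in charts -/

section Charts

variable {X : Type*} [TopologicalSpace X] [ChartedSpace ℂ X]

theorem analyticAt_chart_of_contMDiff {Y : Type*} [TopologicalSpace Y] [ChartedSpace ℂ Y]
    {φ : X → Y} (hφ : ContMDiff 𝓘(ℂ) 𝓘(ℂ) ω φ) (x : X) :
    AnalyticAt ℂ (chartAt ℂ (φ x) ∘ φ ∘ (chartAt ℂ x).symm) (chartAt ℂ x x) := by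
  have h := (contMDiffAt_iff.1 (hφ x)).2
  simp only [mfld_simps, contDiffWithinAt_univ] at h
  exact h.analyticAt

theorem Aut.continuous (g : Aut X) : Continuous fun x : X => g • x :=
  g.2.1.continuous

instance Aut.continuousConstSMul_subgroup (L : Subgroup (Aut X)) : ContinuousConstSMul L X :=
  ⟨fun g => Aut.continuous (g : Aut X)⟩

theorem nhdsNE_neBot (x : X) : (𝓝[≠] x).NeBot := by
  have h := (chartAt ℂ x).symm.tendsto_nhdsNE (mem_chart_target ℂ x)
  rw [OpenPartialHomeomorph.left_inv _ (mem_chart_source ℂ x)] at h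
  exact h.neBot

/-- Near a fixed point, an automorphism is the identity or has no other fixed points. -/
theorem Aut.eventually_eq_or_eventually_ne [T2Space X] (g : Aut X) (x : X) :
    (∀ᶠ y in 𝓝 x, g • y = y) ∨ ∀ᶠ y in 𝓝[≠] x, g • y ≠ y := by
  by_cases hx : g • x = x
  · set c := chartAt ℂ x
    have hxc : x ∈ c.source := mem_chart_source ℂ x
    have ha := analyticAt_chart_of_contMDiff g.2.1 x
    have hgx : (g : Equiv.Perm X) x = x := hx
    rw [hgx] at ha
    have hnear : ∀ᶠ y in 𝓝 x,
        (c ∘ (g : Equiv.Perm X) ∘ c.symm) (c y) = id (c y) ↔ g • y = y := by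
      have h1 : ∀ᶠ y in 𝓝 x, g • y ∈ c.source :=
        (Aut.continuous g).continuousAt.eventually
          (c.open_source.mem_nhds (show g • x ∈ c.source from hx.symm ▸ hxc))
      filter_upwards [h1, c.open_source.mem_nhds hxc] with y hy hyc
      have h2 : (c ∘ (g : Equiv.Perm X) ∘ c.symm) (c y) = c (g • y) := by
        simp only [Function.comp_apply]
        rw [c.left_inv hyc]
        rfl
      rw [h2]
      exact c.injOn.eq_iff hy hyc
    rcases ha.eventually_eq_or_eventually_ne analyticAt_id with h | h
    · left
      filter_upwards [hnear, (c.continuousAt hxc).eventually h] with y hy hy' using hy.1 hy'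
    · right
      filter_upwards [nhdsWithin_le_nhds hnear, (c.tendsto_nhdsNE hxc).eventually h]
        with y hy hy' h3 using hy' (hy.2 h3)
  · right
    refine nhdsWithin_le_nhds ?_
    exact ((Aut.continuous g).continuousAt.prodMk continuousAt_id).eventually
      ((isClosed_diagonal.isOpen_compl).mem_nhds hx)

/-- Identity theorem: the set of points near which `g` is the identity is clopen by the local
dichotomy, so by connectedness it is empty when `g ≠ 1`. -/
theorem Aut.eventually_smul_ne [T2Space X] [ConnectedSpace X] {g : Aut X} (hg : g ≠ 1) (x : X) :
    ∀ᶠ y in 𝓝[≠] x, g • y ≠ y := by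
  refine (Aut.eventually_eq_or_eventually_ne g x).resolve_left fun hx => hg ?_
  have hclopen : IsClopen {x : X | ∀ᶠ y in 𝓝 x, g • y = y} := by
    refine ⟨⟨?_⟩, isOpen_setOfPred_eventually_nhds⟩
    rw [isOpen_iff_eventually]
    intro y hy
    have h1 := (Aut.eventually_eq_or_eventually_ne g y).resolve_left hy
    filter_upwards [eventually_nhdsWithin_iff.1 h1] with z hz h2
    by_cases hzy : z = y
    · exact hy (hzy ▸ h2)
    · exact hz hzy h2.self_of_nhds
  have huniv := hclopen.eq_univ ⟨x, hx⟩
  refine Subtype.ext (Equiv.ext fun y => ?_)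
  have hy : y ∈ {x : X | ∀ᶠ y in 𝓝 x, g • y = y} := huniv ▸ Set.mem_univ y
  exact hy.self_of_nhds

/-- If the fibres of a holomorphic function near `x` are orbits of a finite group `L` of
automorphisms, then its multiplicity at `x` is the order of the stabilizer of `x`. -/
theorem meromorphicOrderAt_sub_eq_card_stabilizer [T2Space X] [ConnectedSpace X]
    (L : Subgroup (Aut X)) [Finite L] {x : X} {ψ : X → ℂ}
    (hψ : AnalyticAt ℂ (ψ ∘ (chartAt ℂ x).symm) (chartAt ℂ x x)) {N : Set X} (hN : N ∈ 𝓝 x)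
    (hfib : ∀ y ∈ N, ∀ y' ∈ N, ψ y = ψ y' ↔ MulAction.orbitRel L X y y') :
    meromorphicOrderAt (fun z => (ψ ∘ (chartAt ℂ x).symm) z - ψ x) (chartAt ℂ x x) =
      ((Nat.card (MulAction.stabilizer L x) : ℤ) : WithTop ℤ) := by
  set c := chartAt ℂ x
  have hxc : x ∈ c.source := mem_chart_source ℂ x
  set F : ℂ → ℂ := fun z => (ψ ∘ c.symm) z - ψ x with hF
  have hFa : AnalyticAt ℂ F (c x) := hψ.sub analyticAt_const
  have hFy : ∀ y ∈ c.source, F (c y) = ψ y - ψ x := fun y hy => by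
    simp only [hF, Function.comp_apply, c.left_inv hy]
  have hsource : c.source ∈ 𝓝 x := c.open_source.mem_nhds hxc
  -- If `ψ` were constant near `x`, a neighbourhood of `x` would lie in the finite orbit of `x`,
  -- making `x` isolated.
  have htop : analyticOrderAt F (c x) ≠ ⊤ := by
    intro h
    have h1 := (c.continuousAt hxc).eventually (analyticOrderAt_eq_top.1 h)
    have hfin : (MulAction.orbit L x \ {x}).Finite := (Set.finite_range fun g : L => g • x).sdiff
    have h2 : ∀ᶠ y in 𝓝 x, y ∉ MulAction.orbit L x \ {x} :=
      hfin.isClosed.isOpen_compl.mem_nhds fun h => h.2 rfl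
    have h3 : ∀ᶠ y in 𝓝 x, y = x := by
      filter_upwards [h1, h2, hsource, hN] with y hy1 hy2 hy3 hy4
      by_contra hne
      rw [hFy y hy3, sub_eq_zero] at hy1
      exact hy2 ⟨(hfib y hy4 x (mem_of_mem_nhds hN)).1 hy1, hne⟩
    have := nhdsNE_neBot x
    obtain ⟨y, hy, hy'⟩ :=
      ((h3.filter_mono nhdsWithin_le_nhds).and (self_mem_nhdsWithin : {x}ᶜ ∈ 𝓝[≠] x)).exists
    exact hy' hy
  obtain ⟨n, hn⟩ := ENat.ne_top_iff_exists.1 htop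
  have hn0 : n ≠ 0 := by
    rintro rfl
    refine hFa.analyticOrderAt_eq_zero.1 hn.symm ?_
    rw [hFy x hxc, sub_self]
  obtain ⟨v, hv, hv0, hFv⟩ := exists_openPartialHomeomorph_pow hFa hn0 hn.symm
  have hW : N ∩ c.source ∩ {y | F (c y) = v (c y) ^ n} ∈ 𝓝 x :=
    Filter.inter_mem (Filter.inter_mem hN hsource) ((c.continuousAt hxc).eventually hFv)
  have hcard := card_stabilizer_eq_of_pow (L := L) (c.trans v) (x := x)
    (by rw [OpenPartialHomeomorph.trans_source]; exact ⟨hxc, hv⟩) hv0 hn0 hW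
    (fun y hy y' hy' => by
      have h1 : v (c y) ^ n = ψ y - ψ x := hy.2.symm.trans (hFy y hy.1.2)
      have h2 : v (c y') ^ n = ψ y' - ψ x := hy'.2.symm.trans (hFy y' hy'.1.2)
      rw [OpenPartialHomeomorph.coe_trans, Function.comp_apply, Function.comp_apply, h1, h2,
        sub_left_inj]
      exact hfib y hy.1.1 y' hy'.1.1)
    (fun g hg => Aut.eventually_smul_ne (g := (g : Aut X))
      (fun h => hg (Subtype.ext h)) x)
  rw [hFa.meromorphicOrderAt_eq, ← hn, ← hcard]
  rfl

end Charts

/-! ### The divisor of a coordinate on the quotient -/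

section Quotient

variable {X : Type*} [TopologicalSpace X] [T2Space X] [ConnectedSpace X] [ChartedSpace ℂ X]

theorem P1.chartAt_coe (z : ℂ) : chartAt ℂ (z : P1) = P1.chartZero :=
  if_neg (OnePoint.coe_ne_infty z)

theorem P1.chartAt_infty : chartAt ℂ (OnePoint.infty : P1) = P1.chartInfty :=
  if_pos rfl

theorem P1.chartInfty_infty : P1.chartInfty OnePoint.infty = 0 := by
  rw [P1.chartInfty_apply, P1.inv_infty, P1.chartZero_coe]

theorem P1.chartZero_eq_inv_chartInfty {w : P1} (hw : w ∈ P1.chartInfty.source)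
    (hw' : w ≠ OnePoint.infty) : P1.chartZero w = (P1.chartInfty w)⁻¹ := by
  obtain ⟨z, rfl⟩ := OnePoint.ne_infty_iff_exists.1 hw'
  have hz : z ≠ 0 := by
    rintro rfl
    rw [P1.chartInfty_source] at hw
    obtain ⟨y, hy⟩ := hw
    rw [P1.inv_zero] at hy
    exact OnePoint.coe_ne_infty y hy
  rw [P1.chartInfty_apply, P1.inv_coe hz, P1.chartZero_coe, P1.chartZero_coe,
    _root_.inv_inv]

/-- Let `φ : X → ℙ¹` be a holomorphic map whose fibres are the orbits of `L`. Then
`D_{L,p} - D_{L,q}`, where `φ q = ∞`, is the divisor of the meromorphic function `φ - φ(p)`. -/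
theorem linEquiv_inducedDivisor_of_infty (L : Subgroup (Aut X)) [Finite L] {φ : X → P1}
    (hφ : ContMDiff 𝓘(ℂ) 𝓘(ℂ) ω φ)
    (hfib : ∀ y y', φ y = φ y' ↔ MulAction.orbitRel L X y y') {p q : X} {a : ℂ}
    (hp : φ p = (a : P1)) (hq : φ q = OnePoint.infty) :
    Divisor.LinEquiv (inducedDivisor L p) (inducedDivisor L q) := by
  have hmult (x : X) :
      meromorphicOrderAt (fun z => ((chartAt ℂ (φ x) ∘ φ) ∘ (chartAt ℂ x).symm) z -
        (chartAt ℂ (φ x) ∘ φ) x) (chartAt ℂ x x) =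
      ((Nat.card (MulAction.stabilizer L x) : ℤ) : WithTop ℤ) := by
    refine meromorphicOrderAt_sub_eq_card_stabilizer L (analyticAt_chart_of_contMDiff hφ x)
      (N := φ ⁻¹' (chartAt ℂ (φ x)).source) ?_ fun y hy y' hy' => ?_
    · exact hφ.continuous.continuousAt
        ((chartAt ℂ (φ x)).open_source.mem_nhds (mem_chart_source ℂ _))
    · rw [← hfib]
      exact (chartAt ℂ (φ x)).injOn.eq_iff hy hy'
  have key (x : X) :
      MeromorphicAt ((fun y => P1.chartZero (φ y) - a) ∘ (chartAt ℂ x).symm) (chartAt ℂ x x) ∧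
      meromorphicOrderAt ((fun y => P1.chartZero (φ y) - a) ∘ (chartAt ℂ x).symm)
        (chartAt ℂ x x) = (((inducedDivisor L p - inducedDivisor L q) x : ℤ) : WithTop ℤ) := by
    have hx := hmult x
    have hax := analyticAt_chart_of_contMDiff hφ x
    rw [Finsupp.sub_apply]
    rcases hw : φ x with _ | c
    · replace hw : φ x = OnePoint.infty := hw
      rw [hw, P1.chartAt_infty] at hx hax
      have hx0 : (P1.chartInfty ∘ φ) x = 0 := by
        rw [Function.comp_apply, hw, P1.chartInfty_infty]
      rw [hx0] at hx
      simp only [sub_zero] at hx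
      set G : ℂ → ℂ := P1.chartInfty ∘ φ ∘ (chartAt ℂ x).symm
      have hG : meromorphicOrderAt G (chartAt ℂ x x) =
        ((Nat.card (MulAction.stabilizer L x) : ℤ) : WithTop ℤ) := hx
      have hG0 : ∀ᶠ z in 𝓝[≠] (chartAt ℂ x x), G z ≠ 0 :=
        (meromorphicOrderAt_ne_top_iff_eventually_ne_zero hax.meromorphicAt).1
          (by rw [hG]; exact WithTop.coe_ne_top)
      have hsrc : ∀ᶠ z in 𝓝[≠] (chartAt ℂ x x),
          φ ((chartAt ℂ x).symm z) ∈ P1.chartInfty.source := by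
        refine nhdsWithin_le_nhds ?_
        have h1 : ContinuousAt (φ ∘ (chartAt ℂ x).symm) (chartAt ℂ x x) :=
          hφ.continuous.continuousAt.comp
            ((chartAt ℂ x).continuousAt_symm (mem_chart_target ℂ x))
        refine h1 (P1.chartInfty.open_source.mem_nhds ?_)
        rw [Function.comp_apply, (chartAt ℂ x).left_inv (mem_chart_source ℂ x), ← P1.chartAt_infty,
          hw]
        exact mem_chart_source ℂ _
      -- With `G = 1 / φ` near a pole, `φ - a = G⁻¹ (1 - a G)`, and the second factor is a unit
      -- since `G` vanishes at the centre. The identity is needed only on a punctured neighbourhood,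
      -- so the value of `P1.chartZero` at `∞` does not matter.
      have heq : (fun y => P1.chartZero (φ y) - a) ∘ (chartAt ℂ x).symm =ᶠ[𝓝[≠] (chartAt ℂ x x)]
          G⁻¹ * fun z => 1 - a * G z := by
        filter_upwards [hG0, hsrc] with z hz hz'
        have hne : φ ((chartAt ℂ x).symm z) ≠ OnePoint.infty := by
          intro h
          refine hz ?_
          show P1.chartInfty (φ ((chartAt ℂ x).symm z)) = 0
          rw [h, P1.chartInfty_infty]
        show P1.chartZero (φ ((chartAt ℂ x).symm z)) - a = (G z)⁻¹ * (1 - a * G z)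
        rw [P1.chartZero_eq_inv_chartInfty hz' hne]
        show (G z)⁻¹ - a = _
        field_simp
      have hunit : AnalyticAt ℂ (fun z => 1 - a * G z) (chartAt ℂ x x) := by fun_prop
      have hGx : G (chartAt ℂ x x) = 0 := by
        show P1.chartInfty (φ ((chartAt ℂ x).symm (chartAt ℂ x x))) = 0
        rw [(chartAt ℂ x).left_inv (mem_chart_source ℂ x), hw, P1.chartInfty_infty]
      have hunit0 : meromorphicOrderAt (fun z => 1 - a * G z) (chartAt ℂ x x) = 0 := by
        rw [hunit.meromorphicOrderAt_eq, hunit.analyticOrderAt_eq_zero.2 (by simp [hGx])]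
        rfl
      refine ⟨(hax.meromorphicAt.inv.mul hunit.meromorphicAt).congr heq.symm, ?_⟩
      rw [meromorphicOrderAt_congr heq,
        meromorphicOrderAt_mul hax.meromorphicAt.inv hunit.meromorphicAt, hunit0, add_zero,
        meromorphicOrderAt_inv, hG,
        inducedDivisor_apply_of_orbitRel L ((hfib x q).1 (hw.trans hq.symm)),
        inducedDivisor_apply_of_not_orbitRel L fun h => OnePoint.infty_ne_coe a
          (hw.symm.trans (((hfib x p).2 h).trans hp)), zero_sub]
      rfl
    · replace hw : φ x = (c : P1) := hw
      rw [hw, P1.chartAt_coe] at hx hax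
      have hx0 : (P1.chartZero ∘ φ) x = c := by
        rw [Function.comp_apply, hw, P1.chartZero_coe]
      rw [hx0] at hx
      have hfa : AnalyticAt ℂ ((fun y => P1.chartZero (φ y) - a) ∘ (chartAt ℂ x).symm)
          (chartAt ℂ x x) := hax.sub analyticAt_const
      refine ⟨hfa.meromorphicAt, ?_⟩
      rw [inducedDivisor_apply_of_not_orbitRel (p := q) L fun h => OnePoint.coe_ne_infty c
          (hw.symm.trans (((hfib x q).2 h).trans hq)), sub_zero]
      by_cases hca : c = a
      · subst hca
        rw [inducedDivisor_apply_of_orbitRel L ((hfib x p).1 (hw.trans hp.symm))]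
        exact hx
      · rw [inducedDivisor_apply_of_not_orbitRel L fun h => hca (OnePoint.coe_injective
          (hw.symm.trans (((hfib x p).2 h).trans hp))), hfa.meromorphicOrderAt_eq,
          hfa.analyticOrderAt_eq_zero.2]
        · rfl
        · rw [Function.comp_apply, (chartAt ℂ x).left_inv (mem_chart_source ℂ x), hw,
            P1.chartZero_coe]
          exact sub_ne_zero.2 hca
  exact ⟨fun y => P1.chartZero (φ y) - a, fun x => (key x).1, fun x => (key x).2⟩

/-- If `X / L ≅ ℙ¹`, then the class of `D_{L,p}` does not depend on `p`. -/
theorem QuotientIsoP1.linEquiv_inducedDivisor {L : Subgroup (Aut X)} [Finite L]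
    (hL : QuotientIsoP1 L) (p q : X) :
    Divisor.LinEquiv (inducedDivisor L p) (inducedDivisor L q) := by
  obtain ⟨_, _, hπ, ⟨Φ⟩⟩ := hL
  set φ : X → P1 := fun x => Φ (Quotient.mk (MulAction.orbitRel L X) x) with hφ_def
  have hφ : ContMDiff 𝓘(ℂ) 𝓘(ℂ) ω φ := Φ.contMDiff.comp hπ
  have hfib (y y' : X) : φ y = φ y' ↔ MulAction.orbitRel L X y y' :=
    Φ.injective.eq_iff.trans Quotient.eq
  obtain ⟨o, ho⟩ : ∃ o, φ o = OnePoint.infty := by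
    obtain ⟨b, hb⟩ := Φ.surjective OnePoint.infty
    obtain ⟨o, rfl⟩ := Quotient.exists_rep b
    exact ⟨o, hb⟩
  -- All divisors are compared with the one over `∞`; a point over `∞` lies in the orbit of `o` and
  -- gives the same divisor.
  have key (p : X) : Divisor.LinEquiv (inducedDivisor L p) (inducedDivisor L o) := by
    rcases hp : φ p with _ | a
    · obtain ⟨g, rfl⟩ := (hfib p o).1 (hp.trans ho.symm)
      show Divisor.LinEquiv (inducedDivisor L (g • o)) (inducedDivisor L o)
      rw [inducedDivisor_smul]
      exact .refl _
    · exact linEquiv_inducedDivisor_of_infty L hφ hfib hp ho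
  exact (key p).trans (key q).symm

end Quotient

end RiemannSurface

/-! ### Comparison of the indices of `L` in `H` and `N` -/

theorem mainTheorem4 {X : Type*} [TopologicalSpace X] [T2Space X] [CompactSpace X]
    [ConnectedSpace X] [ChartedSpace ℂ X] [IsManifold 𝓘(ℂ) ω X]
    (H N L : Subgroup (RiemannSurface.Aut X)) (hLH : L ≤ H) (hLN : L ≤ N)
    (hL : RiemannSurface.QuotientIsoP1 L) :
    ((Nat.card H : ℤ) - (Nat.card N : ℤ) = (Nat.card L : ℤ) →
      ∀ p q r : X, RiemannSurface.Divisor.LinEquiv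
        (RiemannSurface.inducedDivisor H p - RiemannSurface.inducedDivisor N q)
        (RiemannSurface.inducedDivisor L r)) ∧
    (Nat.card H = Nat.card N →
      ∀ p q : X, RiemannSurface.Divisor.LinEquiv
        (RiemannSurface.inducedDivisor H p) (RiemannSurface.inducedDivisor N q)) := by
  open RiemannSurface in
  -- If `L` is infinite, so are `H` and `N`, and all three divisors are zero by convention.
  cases finite_or_infinite L with
  | inr hinf =>
    have := Infinite.of_injective _ (Subgroup.inclusion_injective hLH)
    have := Infinite.of_injective _ (Subgroup.inclusion_injective hLN)
    refine ⟨fun _ p q r => ?_, fun _ p q => ?_⟩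
    · rw [inducedDivisor_of_infinite, inducedDivisor_of_infinite, inducedDivisor_of_infinite,
        sub_zero]
      exact .refl _
    · rw [inducedDivisor_of_infinite, inducedDivisor_of_infinite]
      exact .refl _
  | inl hfin =>
    have hLpos : 0 < Nat.card L := Nat.card_pos
    obtain ⟨m, hm, hH⟩ :=
      exists_linEquiv_nsmul_inducedDivisor hLH hL.linEquiv_inducedDivisor
    obtain ⟨n, hn, hN⟩ :=
      exists_linEquiv_nsmul_inducedDivisor hLN hL.linEquiv_inducedDivisor
    rw [hm, hn]
    refine ⟨fun hcard p q r => ?_, fun hcard p q => ?_⟩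
    · have hmn : m = n + 1 := by
        refine Nat.eq_of_mul_eq_mul_right hLpos ?_
        rw [add_mul, one_mul]
        omega
      have h := (hH p r).sub (hN q r)
      rwa [hmn, succ_nsmul', add_sub_cancel_right] at h
    · have hmn : m = n := Nat.eq_of_mul_eq_mul_right hLpos hcard
      subst hmn
      exact (hH p q).trans (hN q q).symm
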